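/- Let $\mathbb{F}$ be an arbitrary field, and let $\mathcal{R}$ be the variety of (not necessarily associative) $\mathbb{F}$-algebras defined by the identities $[[a,b],c]=0$, $(ab)a=0$ and $(ab)(cd)=0$, where $[a,b]=ab-ba$. Let $F(X)$ be the free algebra of $\mathcal{R}$ on $X=\{x_1,x_2,\ldots\}$. For $y,z\in F(X)$ let $V_{y,z}$ be the linear operator $u\mapsto uV_{y,z}=(yu)z$ on $F(X)$, and let $E_0$ be the associative algebra (without identity) of operators on $F(X)$ generated by all $V_{x_i,x_j}$ with $i<j$. We write $g=g(x_1,\ldots,x_l)\in E_0$ if $g$ lies in the subalgebra (without identity) generated by the $V_{x_i,x_j}$ with $1\le i<j\le l$, and $f=f(x_1,\ldots,x_m)\in F(X)$ if $f$ lies in the subalgebra generated by $x_1,\ldots,x_m$. For a natural number $n$ let $P_n$ be the algebra over $\mathbb{F}$ with linear basis $a_{ij},b_{ij},c_i,d_{ij},e_{ij}$ ($1\le i,j\le n$) and with product $a_{ij}c_i=d_{ij}$, $b_{ij}c_i=e_{ij}$, $a_{ij}e_{ij}=e_{ij}a_{ij}=-b_{ij}d_{ij}=-d_{ij}b_{ij}=c_j$,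 all other products of basis elements being zero; $P_n$ belongs to $\mathcal{R}$. For $f\in F(X)$ we say that $f=0$ is an identity of $P_n$ (or that $P_n$ satisfies $f=0$) if $\varphi(f)=0$ for every algebra homomorphism $\varphi:F(X)\to P_n$. **Proposition.** For every $m\ge 0$ and every $f=f(x_1,\ldots,x_m)\in F(X)$ there exist $t(m)=2m(m+3)$ operator polynomials $g_i=g_i(x_1,\ldots,x_{m+3})\in E_0$, $i=1,\ldots,t(m)$, such that for every $n\ge 2$: $f=0$ is an identity of $P_n$ if and only if $P_n$ satisfies all the identities $z\,g_i(x_1,\ldots,x_{m+3})=0$, $1\le i\le t(m)$, where $z=x_{m+4}$ is a further variable. -/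

import Mathlib

noncomputable section

namespace RAlg

/-- The (nonassociative) `k`-algebra `A` belongs to the variety `R`, i.e. it satisfies the identities
`[[a,b],c] = 0`, `(ab)a = 0` and `(ab)(cd) = 0`. -/
structure InR (A : Type*) [NonUnitalNonAssocRing A] : Prop where
  comm_comm : ∀ a b c : A, (a * b - b * a) * c - c * (a * b - b * a) = 0
  mul_mul_self : ∀ a b : A, (a * b) * a = 0
  metabelian : ∀ a b c d : A, (a * b) * (c * d) = 0

/-! ### The free algebra `F(X)` of the variety, `X = {x 0, x 1, x 2, …}` -/

section Free

variable (k : Type*) [Field k]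

/-- The absolutely free nonassociative algebra on countably many generators. -/
abbrev Abs : Type _ := FreeNonUnitalNonAssocAlgebra k ℕ

/-- `I` is a two-sided ideal of the absolutely free algebra that contains all values of
the defining polynomials of the variety. -/
structure IsRIdeal (I : Submodule k (Abs k)) : Prop where
  mul_left : ∀ u v : Abs k, v ∈ I → u * v ∈ I
  mul_right : ∀ u v : Abs k, u ∈ I → u * v ∈ I
  comm_comm : ∀ a b c : Abs k, (a * b - b * a) * c - c * (a * b - b * a) ∈ I
  mul_mul_self : ∀ a b : Abs k, (a * b) * a ∈ I
  metabelian : ∀ a b c d : Abs k, (a * b) * (c * d) ∈ I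

/-- The smallest two-sided ideal containing all values of the defining polynomials. -/
def rIdeal : Submodule k (Abs k) := sInf {I | IsRIdeal k I}

theorem isRIdeal_rIdeal : IsRIdeal k (rIdeal k) where
  mul_left u v hv := by
    simp only [rIdeal, Submodule.mem_sInf] at hv ⊢
    exact fun I hI => hI.mul_left u v (hv I hI)
  mul_right u v hu := by
    simp only [rIdeal, Submodule.mem_sInf] at hu ⊢
    exact fun I hI => hI.mul_right u v (hu I hI)
  comm_comm a b c := by
    simp only [rIdeal, Submodule.mem_sInf]
    exact fun I hI => hI.comm_comm a b c
  mul_mul_self a b := by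
    simp only [rIdeal, Submodule.mem_sInf]
    exact fun I hI => hI.mul_mul_self a b
  metabelian a b c d := by
    simp only [rIdeal, Submodule.mem_sInf]
    exact fun I hI => hI.metabelian a b c d

/-- The free algebra `F(X)` of the variety `R` over `k`. -/
def F : Type _ := Abs k ⧸ rIdeal k

instance : AddCommGroup (F k) := inferInstanceAs (AddCommGroup (Abs k ⧸ rIdeal k))

instance : Module k (F k) := inferInstanceAs (Module k (Abs k ⧸ rIdeal k))

/-- The quotient map from the absolutely free algebra. -/
def mk : Abs k →ₗ[k] F k := (rIdeal k).mkQ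

theorem mk_surjective : Function.Surjective (mk k) := (rIdeal k).mkQ_surjective

theorem mk_eq_zero {u : Abs k} : mk k u = 0 ↔ u ∈ rIdeal k :=
  Submodule.Quotient.mk_eq_zero _

/-- The bilinear product of `F(X)`, induced by that of the absolutely free algebra. -/
def mulF : F k →ₗ[k] F k →ₗ[k] F k :=
  (rIdeal k).liftQ
    (LinearMap.flip ((rIdeal k).liftQ ((LinearMap.mul k (Abs k)).compr₂ (mk k)).flip (by
      intro v hv
      rw [LinearMap.mem_ker]
      refine LinearMap.ext fun u => ?_
      exact (mk_eq_zero k).2 ((isRIdeal_rIdeal k).mul_left u v hv))))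
    (by
      intro u hu
      rw [LinearMap.mem_ker]
      refine LinearMap.ext fun v => ?_
      obtain ⟨v, rfl⟩ := mk_surjective k v
      exact (mk_eq_zero k).2 ((isRIdeal_rIdeal k).mul_right u v hu))

instance : Mul (F k) := ⟨fun u v => mulF k u v⟩

theorem mk_mul (u v : Abs k) : mk k (u * v) = mk k u * mk k v := rfl

instance : NonUnitalNonAssocRing (F k) where
  left_distrib u v w := (mulF k u).map_add v w
  right_distrib u v w := (mulF k).map_add₂ u v w
  zero_mul u := (mulF k).map_zero₂ u
  mul_zero u := (mulF k u).map_zero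

instance : IsScalarTower k (F k) (F k) := ⟨fun r u v => (mulF k).map_smul₂ r u v⟩

instance : SMulCommClass k (F k) (F k) := ⟨fun r u v => ((mulF k u).map_smul r v).symm⟩

/-- The free generators (the variable `x_{i+1}` is `x k i`). -/
def x (i : ℕ) : F k := mk k (FreeNonUnitalNonAssocAlgebra.of k i)

theorem inR_F : InR (F k) where
  comm_comm a b c := by
    obtain ⟨a, rfl⟩ := mk_surjective k a
    obtain ⟨b, rfl⟩ := mk_surjective k b
    obtain ⟨c, rfl⟩ := mk_surjective k c
    simp only [← mk_mul, ← map_sub]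
    exact (mk_eq_zero k).2 ((isRIdeal_rIdeal k).comm_comm a b c)
  mul_mul_self a b := by
    obtain ⟨a, rfl⟩ := mk_surjective k a
    obtain ⟨b, rfl⟩ := mk_surjective k b
    simp only [← mk_mul]
    exact (mk_eq_zero k).2 ((isRIdeal_rIdeal k).mul_mul_self a b)
  metabelian a b c d := by
    obtain ⟨a, rfl⟩ := mk_surjective k a
    obtain ⟨b, rfl⟩ := mk_surjective k b
    obtain ⟨c, rfl⟩ := mk_surjective k c
    obtain ⟨d, rfl⟩ := mk_surjective k d
    simp only [← mk_mul]
    exact (mk_eq_zero k).2 ((isRIdeal_rIdeal k).metabelian a b c d)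

/-- The universal property: an assignment of the variables in an algebra of the variety extends
uniquely to a homomorphism from `F(X)`. -/
theorem existsUnique_hom {A : Type*} [NonUnitalNonAssocRing A] [Module k A] [IsScalarTower k A A]
    [SMulCommClass k A A] (hA : InR A) (p : ℕ → A) :
    ∃! φ : F k →ₙₐ[k] A, ∀ i, φ (x k i) = p i := by
  let ψ : Abs k →ₙₐ[k] A := FreeNonUnitalNonAssocAlgebra.lift k p
  have hI : IsRIdeal k (LinearMap.ker (ψ : Abs k →ₗ[k] A)) :=
    { mul_left := fun u v hv => by
        have hv' : ψ v = 0 := hv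
        change ψ (u * v) = 0
        rw [map_mul, hv', mul_zero]
      mul_right := fun u v hu => by
        have hu' : ψ u = 0 := hu
        change ψ (u * v) = 0
        rw [map_mul, hu', zero_mul]
      comm_comm := fun a b c => by
        change ψ _ = 0
        simpa only [map_sub, map_mul] using hA.comm_comm (ψ a) (ψ b) (ψ c)
      mul_mul_self := fun a b => by
        change ψ _ = 0
        simpa only [map_mul] using hA.mul_mul_self (ψ a) (ψ b)
      metabelian := fun a b c d => by
        change ψ _ = 0
        simpa only [map_mul] using hA.metabelian (ψ a) (ψ b) (ψ c) (ψ d) }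
  have hle : rIdeal k ≤ LinearMap.ker (ψ : Abs k →ₗ[k] A) := sInf_le hI
  let χ : F k →ₗ[k] A := (rIdeal k).liftQ (ψ : Abs k →ₗ[k] A) hle
  have hχ : ∀ u, χ (mk k u) = ψ u := fun u => rfl
  refine ⟨{ toFun := χ, map_smul' := χ.map_smul, map_zero' := χ.map_zero,
            map_add' := χ.map_add, map_mul' := ?_ }, ?_, ?_⟩
  · intro u v
    obtain ⟨u, rfl⟩ := mk_surjective k u
    obtain ⟨v, rfl⟩ := mk_surjective k v
    rw [← mk_mul, hχ, hχ, hχ, map_mul]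
  · intro i
    exact FreeNonUnitalNonAssocAlgebra.lift_of_apply k p i
  · intro φ hφ
    let π : Abs k →ₙₐ[k] F k :=
      { toFun := mk k, map_smul' := (mk k).map_smul, map_zero' := (mk k).map_zero,
        map_add' := (mk k).map_add, map_mul' := mk_mul k }
    have h : φ.comp π = ψ := by
      apply FreeNonUnitalNonAssocAlgebra.hom_ext
      intro i
      rw [FreeNonUnitalNonAssocAlgebra.lift_of_apply]
      exact hφ i
    ext u
    obtain ⟨u, rfl⟩ := mk_surjective k u
    exact DFunLike.congr_fun h u

/-- The elements `f(x_1, …, x_m)` of `F(X)`: the subalgebra generated by the first `m` variables. -/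
def polys (m : ℕ) : NonUnitalSubalgebra k (F k) :=
  NonUnitalAlgebra.adjoin k {u | ∃ i < m, u = x k i}

/-- The operator `V_{y,z} = L_y R_z` acting on the right: `u V_{y,z} = (y u) z`. -/
def V (y z : F k) : Module.End k (F k) := (LinearMap.mulRight k z) ∘ₗ (LinearMap.mulLeft k y)

/-- The algebra `E_0`: the algebra of operators (without identity) generated by all
`V_{x_i, x_j}` with `i < j`. Operators are written on the right of their arguments, so their product is
composition in the opposite order; the generated set of operators is the same. -/
def E0 : NonUnitalSubalgebra k (Module.End k (F k)) :=
  NonUnitalAlgebra.adjoin k {T | ∃ i j : ℕ, i < j ∧ T = V k (x k i) (x k j)}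

/-- The operator polynomials `g(x_1, …, x_l)` in `E_0`: the subalgebra generated by the
`V_{x_i, x_j}` in the first `l` variables. -/
def E0Vars (l : ℕ) : NonUnitalSubalgebra k (Module.End k (F k)) :=
  NonUnitalAlgebra.adjoin k {T | ∃ i j : ℕ, i < j ∧ j < l ∧ T = V k (x k i) (x k j)}

theorem E0Vars_le_E0 (l : ℕ) : E0Vars k l ≤ E0 k :=
  NonUnitalAlgebra.adjoin_mono fun _ ⟨i, j, hij, _, hT⟩ => ⟨i, j, hij, hT⟩

/-- `f = 0` is an identity of the algebra `A`: `f` vanishes under every homomorphism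
`F(X) → A`, i.e. (for `A` in the variety) under every substitution of elements of `A`. -/
def IsIdentity (A : Type*) [NonUnitalNonAssocRing A] [Module k A] (f : F k) : Prop :=
  ∀ φ : F k →ₙₐ[k] A, φ f = 0

end Free

/-! ### The algebras `P_n` -/

/-- The basis `a_{ij}, b_{ij}, c_i, d_{ij}, e_{ij}` of `P_n`. -/
inductive PBasis (n : ℕ) : Type
  | a (i j : Fin n)
  | b (i j : Fin n)
  | c (i : Fin n)
  | d (i j : Fin n)
  | e (i j : Fin n)

section P

variable (k : Type*) [Field k] (n : ℕ)

/-- The underlying space of `P_n`: the vector space with basis `PBasis n`. -/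
def P : Type _ := PBasis n →₀ k

instance : AddCommGroup (P k n) := inferInstanceAs (AddCommGroup (PBasis n →₀ k))

instance : Module k (P k n) := inferInstanceAs (Module k (PBasis n →₀ k))

/-- The linear basis `a_{ij}, b_{ij}, c_i, d_{ij}, e_{ij}` as a basis of the space `P_n`. -/
def stdBasis : Module.Basis (PBasis n) k (P k n) := Module.Basis.ofRepr (LinearEquiv.refl k _)

open PBasis in
/-- The multiplication table: `a_{ij} c_i = d_{ij}`, `b_{ij} c_i = e_{ij}`,
`a_{ij} e_{ij} = e_{ij} a_{ij} = c_j`, `b_{ij} d_{ij} = d_{ij} b_{ij} = -c_j`; all other products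
of basis elements are zero. -/
def table : PBasis n → PBasis n → P k n
  | a i j, c i' => if i = i' then stdBasis k n (d i j) else 0
  | b i j, c i' => if i = i' then stdBasis k n (e i j) else 0
  | a i j, e i' j' => if i = i' ∧ j = j' then stdBasis k n (c j) else 0
  | e i j, a i' j' => if i = i' ∧ j = j' then stdBasis k n (c j) else 0
  | b i j, d i' j' => if i = i' ∧ j = j' then -stdBasis k n (c j) else 0
  | d i j, b i' j' => if i = i' ∧ j = j' then -stdBasis k n (c j) else 0
  | _, _ => 0

/-- The bilinear product of `P_n`, extending the multiplication table. -/
def mulP : P k n →ₗ[k] P k n →ₗ[k] P k n :=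
  (stdBasis k n).constr k fun u => (stdBasis k n).constr k (table k n u)

instance : Mul (P k n) := ⟨fun u v => mulP k n u v⟩

instance : NonUnitalNonAssocRing (P k n) where
  left_distrib u v w := (mulP k n u).map_add v w
  right_distrib u v w := (mulP k n).map_add₂ u v w
  zero_mul u := (mulP k n).map_zero₂ u
  mul_zero u := (mulP k n u).map_zero

instance : IsScalarTower k (P k n) (P k n) := ⟨fun r u v => (mulP k n).map_smul₂ r u v⟩

instance : SMulCommClass k (P k n) (P k n) := ⟨fun r u v => ((mulP k n u).map_smul r v).symm⟩

theorem stdBasis_mul (u v : PBasis n) : stdBasis k n u * stdBasis k n v = table k n u v := by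
  change mulP k n _ _ = _
  rw [mulP, Module.Basis.constr_basis, Module.Basis.constr_basis]

end P

end RAlg

end

/-!
The algebra `P_n` is graded by `{0, 1, 2}`: the `a`'s and `b`'s have degree `0`, the `c`'s degree `1`
and the `d`'s and `e`'s degree `2`. It is the split null extension of its degree `0` component, which
has zero product, by the ideal of positive degree, and a degree `0` element exchanges the degrees
`1` and `2`.

Hence a polynomial `f` in `x_1, …, x_m` takes on `P_n` the value `∑ r_i x_i + ∑ D_i (x_i⁺)`, where
`x_i⁺` is the positive part of `x_i` and the operator `D_i` depends only on the degree `0` parts of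
the variables (`exists_expansion`). The terms can be separated: `f = 0` is an identity iff all `r_i`
are zero (`linear_eq_zero_of_isIdentity`) and all `D_i` vanish on the positive part of `P_n`
(`posVal_eq_zero_iff`).

Relative to the degrees `1` and `2`, each `D_i` has four blocks. The one from degree `1` to degree `1`
is a polynomial in the operators `V_{x_j,x_k}`. The other three become such polynomials once
degree `2` is entered through a left multiplication by a further variable `z` or left through a right
multiplication by a further variable `y` (`leftFamily_mem`, `rightFamily_mem`, `leftFamily_mul_mem`,
`rightFamily_mul_mem`), and nothing is lost by this, as degree `2` is spanned by the products
`z c_i` and no nonzero element `w` of it has `w y = 0` for all `y` (`projPos_comp_eq_zero_iff`).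
So `4m ≤ 2m(m+3)` operator identities suffice when the `r_i` are zero. If some `r_i` is nonzero, then
`f = 0` is not an identity, and neither is `z V_{x_1,x_2} = 0`.
-/

noncomputable section

namespace RAlg

open PBasis

variable {k : Type*} [Field k] {n m l : ℕ}

/-! ### The grading of `P_n` -/

/-- The degree of a basis vector in the `{0, 1, 2}`-grading of `P_n`: the `a`'s and `b`'s have
degree `0`, the `c`'s degree `1`, the `d`'s and `e`'s degree `2`. -/
def PBasis.deg : PBasis n → Fin 3
  | a _ _ => 0
  | b _ _ => 0
  | c _ => 1
  | d _ _ => 2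
  | e _ _ => 2

variable (k n) in
/-- The projection of `P_n` onto its component of degree `r`. -/
def proj (r : Fin 3) : Module.End k (P k n) :=
  (stdBasis k n).constr k fun u => if u.deg = r then stdBasis k n u else 0

theorem proj_stdBasis (r : Fin 3) (u : PBasis n) :
    proj k n r (stdBasis k n u) = if u.deg = r then stdBasis k n u else 0 :=
  (stdBasis k n).constr_basis ..

theorem proj_proj (r s : Fin 3) (u : P k n) :
    proj k n r (proj k n s u) = if r = s then proj k n r u else 0 := by
  suffices h : proj k n r ∘ₗ proj k n s = if r = s then proj k n r else 0 by
    have := LinearMap.congr_fun h u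
    split_ifs at this ⊢ <;> simpa using this
  refine (stdBasis k n).ext fun u => ?_
  rw [LinearMap.comp_apply, proj_stdBasis]
  split_ifs with h1 h2 h2
  · rfl
  · rw [proj_stdBasis, if_neg fun h => h2 (h.symm.trans h1), LinearMap.zero_apply]
  · rw [map_zero, proj_stdBasis, if_neg fun h => h1 (h.trans h2)]
  · simp

theorem proj_sum (u : P k n) : proj k n 0 u + proj k n 1 u + proj k n 2 u = u := by
  suffices h : proj k n 0 + proj k n 1 + proj k n 2 = LinearMap.id from LinearMap.congr_fun h u
  refine (stdBasis k n).ext fun u => ?_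
  cases u <;> simp [proj_stdBasis, deg]

/-- Two bilinear expressions in elements of `P_n` agree if they do on basis vectors. -/
theorem bilin_ext {f g : P k n →ₗ[k] P k n →ₗ[k] P k n}
    (h : ∀ u v, f (stdBasis k n u) (stdBasis k n v) = g (stdBasis k n u) (stdBasis k n v)) :
    f = g :=
  (stdBasis k n).ext fun u => (stdBasis k n).ext fun v => h u v

theorem proj_zero_mul (u v : P k n) : proj k n 0 (u * v) = 0 := by
  suffices h : (LinearMap.mul k (P k n)).compr₂ (proj k n 0) = 0 from
    LinearMap.congr_fun₂ h u v
  refine bilin_ext fun u v => ?_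
  cases u <;> cases v <;>
    simp [stdBasis_mul, table, apply_ite (proj k n 0), proj_stdBasis, deg]

theorem proj_one_mul (u v : P k n) :
    proj k n 1 (u * v) = proj k n 0 u * proj k n 2 v + proj k n 2 u * proj k n 0 v := by
  suffices h : (LinearMap.mul k (P k n)).compr₂ (proj k n 1) =
      (LinearMap.mul k (P k n)).compl₁₂ (proj k n 0) (proj k n 2) +
      (LinearMap.mul k (P k n)).compl₁₂ (proj k n 2) (proj k n 0) from
    LinearMap.congr_fun₂ h u v
  refine bilin_ext fun u v => ?_
  cases u <;> cases v <;>
    simp [stdBasis_mul, table, apply_ite (proj k n 1), proj_stdBasis, deg]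

theorem proj_two_mul (u v : P k n) :
    proj k n 2 (u * v) = proj k n 0 u * proj k n 1 v := by
  suffices h : (LinearMap.mul k (P k n)).compr₂ (proj k n 2) =
      (LinearMap.mul k (P k n)).compl₁₂ (proj k n 0) (proj k n 1) from
    LinearMap.congr_fun₂ h u v
  refine bilin_ext fun u v => ?_
  cases u <;> cases v <;>
    simp [stdBasis_mul, table, apply_ite (proj k n 2), proj_stdBasis, deg]

theorem proj_zero_mul_proj_two_comm (u v : P k n) :
    proj k n 0 u * proj k n 2 v = proj k n 2 v * proj k n 0 u := by
  suffices h : (LinearMap.mul k (P k n)).compl₁₂ (proj k n 0) (proj k n 2) =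
      ((LinearMap.mul k (P k n)).compl₁₂ (proj k n 2) (proj k n 0)).flip from
    LinearMap.congr_fun₂ h u v
  refine bilin_ext fun u v => ?_
  cases u <;> cases v <;> simp [stdBasis_mul, table, proj_stdBasis, deg]
  all_goals grind

/-- An element of `P_n` is determined by its components. -/
theorem ext_proj {u v : P k n} (h0 : proj k n 0 u = proj k n 0 v)
    (h1 : proj k n 1 u = proj k n 1 v) (h2 : proj k n 2 u = proj k n 2 v) : u = v := by
  rw [← proj_sum u, ← proj_sum v, h0, h1, h2]

theorem stdBasis_mul_mul_self (u v : PBasis n) :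
    stdBasis k n u * stdBasis k n v * stdBasis k n u = 0 := by
  cases u <;> cases v <;> simp [stdBasis_mul, table, ite_mul]

theorem stdBasis_mul_mul_swap (u v w : PBasis n) :
    stdBasis k n u * stdBasis k n v * stdBasis k n w +
      stdBasis k n w * stdBasis k n v * stdBasis k n u = 0 := by
  cases u <;> cases v <;> cases w <;> simp [stdBasis_mul, table, ite_mul]
  all_goals grind

/-- The map `(u, w) ↦ (u v) w` is alternating. Over a field of characteristic `2` this does not
follow from skew symmetry, so the diagonal values on the basis are needed as well. -/
theorem mul_mul_self_P (u v : P k n) : u * v * u = 0 := by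
  suffices h : LinearMap.mulRight k u ∘ₗ LinearMap.mulLeft k u = 0 from LinearMap.congr_fun h v
  refine (stdBasis k n).ext fun v => ?_
  let B : P k n →ₗ[k] P k n →ₗ[k] P k n :=
    LinearMap.mul k (P k n) ∘ₗ LinearMap.mulRight k (stdBasis k n v)
  have hB : B + B.flip = 0 := bilin_ext fun u w => stdBasis_mul_mul_swap u v w
  change B u u = 0
  induction (stdBasis k n).mem_span u using Submodule.span_induction with
  | mem u hu =>
    obtain ⟨u, rfl⟩ := hu
    exact stdBasis_mul_mul_self u v
  | zero => simp
  | add u w _ _ hu hw =>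
    have h : B u w + B w u = 0 := LinearMap.congr_fun₂ hB u w
    rw [map_add, LinearMap.map_add₂, LinearMap.map_add₂, hu, hw, zero_add, add_zero, add_comm, h]
  | smul r u _ hu => rw [map_smul, LinearMap.map_smul₂, hu, smul_zero, smul_zero]

theorem inR_P : InR (P k n) where
  comm_comm a b c := by
    have h0 : proj k n 0 (a * b - b * a) = 0 := by simp [proj_zero_mul]
    have h1 : proj k n 1 (a * b - b * a) = 0 := by
      rw [map_sub, proj_one_mul, proj_one_mul, proj_zero_mul_proj_two_comm a,
        proj_zero_mul_proj_two_comm b, add_comm, sub_self]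
    generalize a * b - b * a = w at h0 h1 ⊢
    refine ext_proj ?_ ?_ ?_
    · simp [proj_zero_mul]
    · simp [proj_one_mul, h0, proj_zero_mul_proj_two_comm]
    · simp [proj_two_mul, h0, h1]
  mul_mul_self := mul_mul_self_P
  metabelian a b c d := by
    refine ext_proj ?_ ?_ ?_ <;> simp [proj_zero_mul, proj_one_mul, proj_two_mul]

theorem exists_hom (p : ℕ → P k n) : ∃ φ : F k →ₙₐ[k] P k n, ∀ i, φ (x k i) = p i :=
  (existsUnique_hom k inR_P p).exists

/-- An element `w` of degree `2` with `w y = 0` for all `y` is zero: right multiplication by `a_{ij}`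
and `b_{ij}` reads off its coordinates at `e_{ij}` and `d_{ij}`. -/
theorem proj_two_eq_zero {w : P k n} (h : ∀ y, proj k n 2 w * y = 0) : proj k n 2 w = 0 := by
  have key : ∀ u : PBasis n, (stdBasis k n).coord u (proj k n 2 w) = 0 := by
    classical
    have hA (i j : Fin n) : LinearMap.mulRight k (stdBasis k n (a i j)) ∘ₗ proj k n 2 =
        ((stdBasis k n).coord (e i j) ∘ₗ proj k n 2).smulRight (stdBasis k n (c j)) := by
      refine (stdBasis k n).ext fun u => ?_
      cases u <;> simp [proj_stdBasis, deg, stdBasis_mul, table, Finsupp.single_apply]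
      grind
    have hB (i j : Fin n) : LinearMap.mulRight k (stdBasis k n (b i j)) ∘ₗ proj k n 2 =
        ((stdBasis k n).coord (d i j) ∘ₗ proj k n 2).smulRight (-stdBasis k n (c j)) := by
      refine (stdBasis k n).ext fun u => ?_
      cases u <;> simp [proj_stdBasis, deg, stdBasis_mul, table, Finsupp.single_apply]
      grind
    have h0 (u : PBasis n) (hu : u.deg ≠ 2) : (stdBasis k n).coord u ∘ₗ proj k n 2 = 0 := by
      refine (stdBasis k n).ext fun v => ?_
      simp only [LinearMap.comp_apply, proj_stdBasis]
      split_ifs with hv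
      · have : v ≠ u := fun h => hu (h ▸ hv)
        simp [this]
      · simp
    intro u
    cases u with
    | a i j => exact LinearMap.congr_fun (h0 (a i j) (by simp [deg])) w
    | b i j => exact LinearMap.congr_fun (h0 (b i j) (by simp [deg])) w
    | c i => exact LinearMap.congr_fun (h0 (c i) (by simp [deg])) w
    | d i j =>
      have := (LinearMap.congr_fun (hB i j) w).symm.trans (h _)
      simpa [(stdBasis k n).ne_zero] using this
    | e i j =>
      have := (LinearMap.congr_fun (hA i j) w).symm.trans (h _)
      simpa [(stdBasis k n).ne_zero] using this
  exact (stdBasis k n).ext_elem fun u => by simpa using key u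

/-- An operator that kills the degree `2` parts of all products `y u` kills the whole component of
degree `2`, since `d_{ij} = a_{ij} c_i` and `e_{ij} = b_{ij} c_i`. -/
theorem comp_proj_two_eq_zero {T : Module.End k (P k n)}
    (h : ∀ y u, T (proj k n 2 (y * u)) = 0) (w : P k n) : T (proj k n 2 w) = 0 := by
  suffices h : T ∘ₗ proj k n 2 = 0 from LinearMap.congr_fun h w
  refine (stdBasis k n).ext fun u => ?_
  rw [LinearMap.comp_apply, proj_stdBasis]
  cases u with
  | d i j =>
    have := h (stdBasis k n (a i j)) (stdBasis k n (c i))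
    simpa [stdBasis_mul, table, proj_stdBasis, deg] using this
  | e i j =>
    have := h (stdBasis k n (b i j)) (stdBasis k n (c i))
    simpa [stdBasis_mul, table, proj_stdBasis, deg] using this
  | _ => simp [deg]

/-! ### The operators `V` on the free algebra -/

theorem V_apply (y z u : F k) : V k y z u = y * u * z := rfl

theorem V_swap (y z : F k) : V k z y = -V k y z := by
  refine LinearMap.ext fun u => ?_
  have h := (inR_F k).mul_mul_self (y + z) u
  simp only [add_mul, mul_add, (inR_F k).mul_mul_self] at h
  rw [LinearMap.neg_apply, V_apply, V_apply, eq_neg_iff_add_eq_zero]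
  simpa using h

theorem V_self (y : F k) : V k y y = 0 :=
  LinearMap.ext fun u => (inR_F k).mul_mul_self y u

/-- The generators `V_{x_i,x_j}` of `E_0` have `i < j`, but `V` is alternating. -/
theorem V_mem_E0Vars {l i j : ℕ} (hi : i < l) (hj : j < l) : V k (x k i) (x k j) ∈ E0Vars k l := by
  rcases lt_trichotomy i j with h | rfl | h
  · exact NonUnitalAlgebra.subset_adjoin k ⟨i, j, h, hj, rfl⟩
  · rw [V_self]; exact zero_mem _
  · rw [V_swap]; exact neg_mem (NonUnitalAlgebra.subset_adjoin k ⟨j, i, h, hi, rfl⟩)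

/-! ### Operators on `P_n` induced by `E_0` -/

variable (k) in
/-- The families of operators `θ φ` on `P_n`, one for each homomorphism `φ : F(X) → P_n`, that are
induced by a single operator polynomial `g(x_1, …, x_l)` of `E_0`: `φ ∘ g = θ φ ∘ φ` for all `φ`. -/
def induced (l : ℕ) : Submodule k (∀ n, (F k →ₙₐ[k] P k n) → Module.End k (P k n)) where
  carrier := {θ | ∃ g ∈ E0Vars k l, ∀ n (φ : F k →ₙₐ[k] P k n) u, φ (g u) = θ n φ (φ u)}
  zero_mem' := ⟨0, zero_mem _, fun n φ u => by simp⟩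
  add_mem' := by
    rintro θ η ⟨g, hg, hgθ⟩ ⟨h, hh, hhη⟩
    exact ⟨g + h, add_mem hg hh, fun n φ u => by simp [hgθ, hhη]⟩
  smul_mem' := by
    rintro r θ ⟨g, hg, hgθ⟩
    exact ⟨r • g, SMulMemClass.smul_mem r hg, fun n φ u => by simp [hgθ]⟩

theorem induced_congr {l : ℕ} {θ η : ∀ n, (F k →ₙₐ[k] P k n) → Module.End k (P k n)}
    (hη : η ∈ induced k l) (h : ∀ n φ u, θ n φ u = η n φ u) : θ ∈ induced k l := by
  rwa [show θ = η from funext fun n => funext fun φ => LinearMap.ext (h n φ)]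

/-- The operators `V_{x_i,x_j}` are induced for any order of `i` and `j`. -/
theorem V_mem_induced {l i j : ℕ} (hi : i < l) (hj : j < l) :
    (fun _ φ => LinearMap.mulRight k (φ (x k j)) ∘ₗ LinearMap.mulLeft k (φ (x k i))) ∈
      induced k l :=
  ⟨_, V_mem_E0Vars hi hj, fun n φ u => by simp [V_apply]⟩

theorem mul_mem_induced {l : ℕ} {θ η : ∀ n, (F k →ₙₐ[k] P k n) → Module.End k (P k n)}
    (hθ : θ ∈ induced k l) (hη : η ∈ induced k l) : θ * η ∈ induced k l := by
  obtain ⟨g, hg, hgθ⟩ := hθ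
  obtain ⟨h, hh, hhη⟩ := hη
  exact ⟨g * h, mul_mem hg hh, fun n φ u => by simp [hgθ, hhη]⟩

/-! ### Operator families and their blocks -/

variable (k) in
/-- Families of operators on the algebras `P_n` that depend on `m` elements of `P_n`. -/
abbrev OpFamily (m : ℕ) : Type _ := ∀ n, (Fin m → P k n) → Module.End k (P k n)

/-- The components of degree `0` of the values of the first `m` variables. -/
def degZeroVals (m : ℕ) (φ : F k →ₙₐ[k] P k n) : Fin m → P k n := fun j => proj k n 0 (φ (x k j))

/-- Maps into the component of degree `1`: the projection, and, for each variable `y`, the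
projection to degree `2` followed by right multiplication by the value of `y`. -/
def outMap {l : ℕ} (φ : F k →ₙₐ[k] P k n) : Option (Fin l) → Module.End k (P k n)
  | none => proj k n 1
  | some y => LinearMap.mulRight k (φ (x k y)) ∘ₗ proj k n 2

/-- Maps out of the component of degree `1`: the projection to it, and, for each variable `y`,
the left multiplication by the value of `y` with values in degree `2`. -/
def inMap {l : ℕ} (φ : F k →ₙₐ[k] P k n) : Option (Fin l) → Module.End k (P k n)
  | none => proj k n 1
  | some y => proj k n 2 ∘ₗ LinearMap.mulLeft k (φ (x k y))

/-- The block of an operator family `D` cut out by an incoming and an outgoing map; all blocks are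
operators on the component of degree `1`. -/
def block {m l : ℕ} (o i : Option (Fin l)) :
    OpFamily k m →ₗ[k] ∀ n, (F k →ₙₐ[k] P k n) → Module.End k (P k n) where
  toFun D n φ := outMap φ o ∘ₗ D n (degZeroVals m φ) ∘ₗ inMap φ i
  map_add' D D' := by ext; simp
  map_smul' r D := by ext; simp

variable (k) in
/-- The operator families all of whose blocks are induced by operator polynomials of `E_0`. -/
def realizable (m l : ℕ) : Submodule k (OpFamily k m) :=
  ⨅ (o : Option (Fin l)) (i : Option (Fin l)), (induced k l).comap (block o i)

theorem mem_realizable {m l : ℕ} {D : OpFamily k m} :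
    D ∈ realizable k m l ↔ ∀ o i : Option (Fin l), block o i D ∈ induced k l := by
  simp [realizable]

variable (k) in
/-- Left multiplication by a linear combination of the given elements. -/
def leftFamily {m : ℕ} : (Fin m → k) →ₗ[k] OpFamily k m where
  toFun r _ v := LinearMap.mulLeft k (∑ j, r j • v j)
  map_add' r s := by ext; simp [add_smul, Finset.sum_add_distrib, add_mul]
  map_smul' r s := by ext; simp [mul_smul, ← Finset.smul_sum, smul_mul_assoc]

variable (k) in
/-- Right multiplication by a linear combination of the given elements. -/
def rightFamily {m : ℕ} : (Fin m → k) →ₗ[k] OpFamily k m where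
  toFun r _ v := LinearMap.mulRight k (∑ j, r j • v j)
  map_add' r s := by ext; simp [add_smul, Finset.sum_add_distrib, mul_add]
  map_smul' r s := by ext; simp [mul_smul, ← Finset.smul_sum, mul_smul_comm]

/-- A linear map from `k^m` lands in a submodule if it maps the unit vectors into it. -/
theorem mem_of_single {M : Type*} [AddCommGroup M] [Module k M] {N : Submodule k M}
    (T : (Fin m → k) →ₗ[k] M) (h : ∀ j, T (Pi.single j 1) ∈ N) (r : Fin m → k) : T r ∈ N := by
  rw [pi_eq_sum_univ' r, map_sum]
  refine sum_mem fun j _ => ?_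
  rw [map_smul]
  convert N.smul_mem _ (h j) using 4

theorem leftFamily_single (j : Fin m) (v : Fin m → P k n) :
    leftFamily k (Pi.single j 1) n v = LinearMap.mulLeft k (v j) := by
  simp [leftFamily, Pi.single_apply]

theorem rightFamily_single (j : Fin m) (v : Fin m → P k n) :
    rightFamily k (Pi.single j 1) n v = LinearMap.mulRight k (v j) := by
  simp [rightFamily, Pi.single_apply]

/-! ### Families with induced blocks -/

theorem mul_mul_eq_proj_two_mul (y z u : P k n) : y * u * z = proj k n 2 (y * u) * z := by
  refine ext_proj ?_ ?_ ?_ <;>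
    simp [proj_zero_mul, proj_one_mul, proj_two_mul, proj_proj]

theorem mul_mul_eq_mul_proj_one_mul (y z u : P k n) : y * u * z = y * proj k n 1 u * z := by
  refine ext_proj ?_ ?_ ?_ <;>
    simp [proj_zero_mul, proj_one_mul, proj_two_mul, proj_proj]

theorem outMap_none_left_mul (φ : F k →ₙₐ[k] P k n) (j : Fin l) (w : P k n) :
    outMap (l := l) φ none (proj k n 0 (φ (x k j)) * w) = outMap φ (some j) w := by
  refine ext_proj ?_ ?_ ?_
  · simp [outMap, proj_zero_mul, proj_proj]
  · simp [outMap, proj_one_mul, proj_proj, ← proj_zero_mul_proj_two_comm]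
  · simp [outMap, proj_two_mul, proj_proj]

theorem outMap_some_left_mul (φ : F k →ₙₐ[k] P k n) (y : Fin l) (a w : P k n) :
    outMap φ (some y) (proj k n 0 a * w) = a * proj k n 1 w * φ (x k y) := by
  refine ext_proj ?_ ?_ ?_ <;>
    simp [outMap, proj_zero_mul, proj_one_mul, proj_two_mul, proj_proj]

theorem outMap_none_right_mul (φ : F k →ₙₐ[k] P k n) (j : Fin l) (w : P k n) :
    outMap (l := l) φ none (w * proj k n 0 (φ (x k j))) = outMap φ (some j) w := by
  refine ext_proj ?_ ?_ ?_ <;>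
    simp [outMap, proj_zero_mul, proj_one_mul, proj_two_mul, proj_proj]

theorem outMap_some_right_mul (φ : F k →ₙₐ[k] P k n) (y : Fin l) (a w : P k n) :
    outMap φ (some y) (w * proj k n 0 a) = 0 := by
  simp [outMap, proj_two_mul, proj_proj]

/-- An incoming map followed by right multiplication by `x_j` on degree `2` is zero or the operator
induced by `V_{x_z,x_j}`. -/
theorem outMap_some_inMap_mem (j : Fin l) (i : Option (Fin l)) :
    (fun n φ => outMap (n := n) φ (some j) ∘ₗ inMap φ i) ∈ induced k l := by
  rcases i with _ | z
  · refine induced_congr (zero_mem _) fun n φ u => ?_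
    simp [outMap, inMap, proj_proj]
  · refine induced_congr (V_mem_induced z.2 j.2) fun n φ u => ?_
    simp [outMap, inMap, proj_proj, mul_mul_eq_proj_two_mul (φ (x k z)) (φ (x k j))]

theorem leftFamily_mem (hml : m ≤ l) (r : Fin m → k) : leftFamily k r ∈ realizable k m l := by
  refine mem_of_single (leftFamily k) (fun j => mem_realizable.2 ?_) r
  let j' : Fin l := j.castLE hml
  rintro (_ | y) i
  · refine induced_congr (outMap_some_inMap_mem j' i) fun n φ u => ?_
    simpa [block, leftFamily_single, degZeroVals, j'] using outMap_none_left_mul φ j' _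
  · rcases i with _ | z
    · refine induced_congr (V_mem_induced j'.2 y.2) fun n φ u => ?_
      simp [block, inMap, leftFamily_single, degZeroVals, outMap_some_left_mul, proj_proj, j',
        ← mul_mul_eq_mul_proj_one_mul]
    · refine induced_congr (zero_mem _) fun n φ u => ?_
      simp [block, inMap, leftFamily_single, degZeroVals, outMap_some_left_mul, proj_proj]

theorem rightFamily_mem (hml : m ≤ l) (r : Fin m → k) : rightFamily k r ∈ realizable k m l := by
  refine mem_of_single (rightFamily k) (fun j => mem_realizable.2 ?_) r
  let j' : Fin l := j.castLE hml
  rintro (_ | y) i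
  · refine induced_congr (outMap_some_inMap_mem j' i) fun n φ u => ?_
    simpa [block, rightFamily_single, degZeroVals, j'] using outMap_none_right_mul φ j' _
  · refine induced_congr (zero_mem _) fun n φ u => ?_
    simp [block, rightFamily_single, degZeroVals, outMap_some_right_mul]

/-- After left multiplication by `x_j`, the outgoing projection to degree `1` becomes the outgoing map
of `x_j`, and the outgoing map of `x_y` becomes the projection followed by `V_{x_j,x_y}`. So the blocks
for all variables have to be treated together. -/
theorem leftFamily_mul_mem (hml : m ≤ l) (r : Fin m → k) {D : OpFamily k m}
    (hD : D ∈ realizable k m l) : leftFamily k r * D ∈ realizable k m l := by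
  refine mem_of_single (LinearMap.mulRight k D ∘ₗ leftFamily k) (fun j => mem_realizable.2 ?_) r
  let j' : Fin l := j.castLE hml
  rw [mem_realizable] at hD
  rintro (_ | y) i
  · refine induced_congr (hD (some j') i) fun n φ u => ?_
    simpa [block, leftFamily_single, degZeroVals, j'] using outMap_none_left_mul φ j' _
  · refine induced_congr (mul_mem_induced (V_mem_induced j'.2 y.2) (hD none i)) fun n φ u => ?_
    simp [block, outMap_some_left_mul, leftFamily_single, degZeroVals, j']
    rfl

theorem rightFamily_mul_mem (hml : m ≤ l) (r : Fin m → k) {D : OpFamily k m}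
    (hD : D ∈ realizable k m l) : rightFamily k r * D ∈ realizable k m l := by
  refine mem_of_single (LinearMap.mulRight k D ∘ₗ rightFamily k) (fun j => mem_realizable.2 ?_) r
  let j' : Fin l := j.castLE hml
  rw [mem_realizable] at hD
  rintro (_ | y) i
  · refine induced_congr (hD (some j') i) fun n φ u => ?_
    simpa [block, rightFamily_single, degZeroVals, j'] using outMap_none_right_mul φ j' _
  · refine induced_congr (zero_mem _) fun n φ u => ?_
    simp [block, rightFamily_single, degZeroVals, outMap_some_right_mul]

/-! ### The expansion of a polynomial on `P_n` -/

variable (k n) in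
/-- The projection of `P_n` onto the ideal spanned by the `c`'s, `d`'s and `e`'s. -/
def projPos : Module.End k (P k n) := proj k n 1 + proj k n 2

theorem projPos_apply (u : P k n) : projPos k n u = proj k n 1 u + proj k n 2 u := rfl

/-- `P_n` is the split null extension of its degree `0` component (with zero product) by
the ideal of positive degree. -/
theorem mul_eq_projPos (u v : P k n) :
    u * v = projPos k n (proj k n 0 u * projPos k n v) +
      projPos k n (projPos k n u * proj k n 0 v) := by
  refine ext_proj ?_ ?_ ?_ <;>
    simp [projPos_apply, proj_zero_mul, proj_one_mul, proj_two_mul, proj_proj]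

theorem mul_projPos (u w : P k n) :
    u * projPos k n w = projPos k n (proj k n 0 u * w) := by
  refine ext_proj ?_ ?_ ?_ <;>
    simp [projPos_apply, proj_zero_mul, proj_one_mul, proj_two_mul, proj_proj]

theorem projPos_mul (u w : P k n) :
    projPos k n w * u = projPos k n (w * proj k n 0 u) := by
  refine ext_proj ?_ ?_ ?_ <;>
    simp [projPos_apply, proj_zero_mul, proj_one_mul, proj_two_mul, proj_proj]

theorem proj_zero_projPos (w : P k n) : proj k n 0 (projPos k n w) = 0 := by
  simp [projPos_apply, proj_proj]

/-- The value at `φ` of the linear form `∑ r_i x_i`. -/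
def linVal (φ : F k →ₙₐ[k] P k n) (r : Fin m → k) : P k n := ∑ i, r i • φ (x k i)

/-- The value at `φ` of a tuple `D` of operator families: the positive part of the sum of the `D i`
applied to the positive parts of the values of the `x_i`. -/
def posVal (φ : F k →ₙₐ[k] P k n) (D : Fin m → OpFamily k m) : P k n :=
  projPos k n (∑ i, D i n (degZeroVals m φ) (projPos k n (φ (x k i))))

theorem leftFamily_apply (φ : F k →ₙₐ[k] P k n) (r : Fin m → k) (w : P k n) :
    leftFamily k r n (degZeroVals m φ) w = proj k n 0 (linVal φ r) * w := by
  simp [leftFamily, degZeroVals, linVal]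

theorem rightFamily_apply (φ : F k →ₙₐ[k] P k n) (r : Fin m → k) (w : P k n) :
    rightFamily k r n (degZeroVals m φ) w = w * proj k n 0 (linVal φ r) := by
  simp [rightFamily, degZeroVals, linVal]

theorem projPos_linVal (φ : F k →ₙₐ[k] P k n) (r : Fin m → k) :
    projPos k n (linVal φ r) = ∑ i, r i • projPos k n (φ (x k i)) := by
  simp [linVal]

/-- The Leibniz rule: the product of two expansions is again an expansion. -/
theorem expansion_mul (φ : F k →ₙₐ[k] P k n) (r s : Fin m → k) (D E : Fin m → OpFamily k m) :
    (linVal φ r + posVal φ D) * (linVal φ s + posVal φ E) =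
      posVal φ fun i => s i • leftFamily k r + r i • rightFamily k s + leftFamily k r * E i +
        rightFamily k s * D i := by
  have h1 : linVal φ r * linVal φ s =
      posVal φ fun i => s i • leftFamily k r + r i • rightFamily k s := by
    rw [mul_eq_projPos, projPos_linVal, projPos_linVal, ← map_add, Finset.mul_sum, Finset.sum_mul,
      ← Finset.sum_add_distrib]
    simp [posVal, leftFamily_apply, rightFamily_apply, mul_smul_comm, smul_mul_assoc]
  have h2 : linVal φ r * posVal φ E = posVal φ fun i => leftFamily k r * E i := by
    rw [posVal, mul_projPos, Finset.mul_sum]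
    simp [posVal, leftFamily_apply]
  have h3 : posVal φ D * linVal φ s = posVal φ fun i => rightFamily k s * D i := by
    rw [posVal, projPos_mul, Finset.sum_mul]
    simp [posVal, rightFamily_apply]
  have h4 : posVal φ D * posVal φ E = 0 := by
    rw [posVal, posVal, mul_projPos, proj_zero_projPos, zero_mul, map_zero]
  rw [add_mul, mul_add, mul_add, h1, h2, h3, h4]
  simp [posVal, Finset.sum_add_distrib]

/-- Every polynomial in the first `m` variables takes on every `P_n` the values of a linear form plus
operator families with induced blocks applied to the positive parts of the variables. The linear form
is kept apart because `E_0` has no identity: the constant family of identity operators is not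
realizable. -/
theorem exists_expansion (hml : m ≤ l) {f : F k} (hf : f ∈ polys k m) :
    ∃ (r : Fin m → k) (D : Fin m → OpFamily k m), (∀ i, D i ∈ realizable k m l) ∧
      ∀ n (φ : F k →ₙₐ[k] P k n), φ f = linVal φ r + posVal φ D := by
  induction hf using NonUnitalAlgebra.adjoin_induction with
  | mem u hu =>
    obtain ⟨i, hi, rfl⟩ := hu
    refine ⟨Pi.single ⟨i, hi⟩ 1, 0, fun _ => zero_mem _, fun n φ => ?_⟩
    simp [linVal, posVal, Pi.single_apply]
  | zero => exact ⟨0, 0, fun _ => zero_mem _, fun n φ => by simp [linVal, posVal]⟩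
  | add f g _ _ hf hg =>
    obtain ⟨r, D, hD, hf⟩ := hf
    obtain ⟨s, E, hE, hg⟩ := hg
    refine ⟨r + s, D + E, fun i => add_mem (hD i) (hE i), fun n φ => ?_⟩
    rw [map_add, hf, hg]
    simp [linVal, posVal, add_smul, Finset.sum_add_distrib]
    abel
  | mul f g _ _ hf hg =>
    obtain ⟨r, D, hD, hf⟩ := hf
    obtain ⟨s, E, hE, hg⟩ := hg
    refine ⟨0, fun i => s i • leftFamily k r + r i • rightFamily k s + leftFamily k r * E i +
      rightFamily k s * D i, fun i => ?_, fun n φ => ?_⟩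
    · exact add_mem (add_mem (add_mem (Submodule.smul_mem _ _ (leftFamily_mem hml r))
        (Submodule.smul_mem _ _ (rightFamily_mem hml s))) (leftFamily_mul_mem hml r (hE i)))
        (rightFamily_mul_mem hml s (hD i))
    · rw [map_mul, hf, hg, expansion_mul]
      simp [linVal]
  | smul t f _ hf =>
    obtain ⟨r, D, hD, hf⟩ := hf
    refine ⟨t • r, t • D, fun i => Submodule.smul_mem _ t (hD i), fun n φ => ?_⟩
    rw [map_smul, hf]
    simp [linVal, posVal, mul_smul, Finset.smul_sum]

/-! ### Separating the terms of the expansion -/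

theorem exists_hom_append (v : Fin m → P k n) (q : ℕ → P k n) :
    ∃ φ : F k →ₙₐ[k] P k n, (∀ i : Fin m, φ (x k i) = v i) ∧ ∀ i, m ≤ i → φ (x k i) = q i := by
  obtain ⟨φ, hφ⟩ := exists_hom fun i => if h : i < m then v ⟨i, h⟩ else q i
  exact ⟨φ, fun i => by simp [hφ], fun i hi => by simp [hφ, hi.not_gt]⟩

/-- The tuple `D` vanishes on `P_n` as an expression in the variables iff each of its operators
vanishes on the ideal of positive degree: the positive part of `x_i` can be varied alone. -/
theorem posVal_eq_zero_iff (D : Fin m → OpFamily k m) :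
    (∀ φ : F k →ₙₐ[k] P k n, posVal φ D = 0) ↔ ∀ (i : Fin m) (φ : F k →ₙₐ[k] P k n) (u : P k n),
      projPos k n (D i n (degZeroVals m φ) (projPos k n u)) = 0 := by
  refine ⟨fun h i φ u => ?_, fun h φ => ?_⟩
  · obtain ⟨ψ, hψ, -⟩ := exists_hom_append
      (fun j => degZeroVals m φ j + if j = i then projPos k n u else 0) 0
    have hdeg : degZeroVals m ψ = degZeroVals m φ := by
      funext j
      rw [degZeroVals, hψ, map_add, apply_ite (proj k n 0), proj_zero_projPos]
      simp [degZeroVals, proj_proj]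
    have hpos (j : Fin m) : projPos k n (ψ (x k j)) = if j = i then projPos k n u else 0 := by
      rw [hψ, map_add, apply_ite (projPos k n)]
      simp [degZeroVals, projPos_apply, proj_proj]
    have := h ψ
    rw [posVal, hdeg, Finset.sum_congr rfl fun j _ => by rw [hpos j],
      Finset.sum_eq_single_of_mem i (Finset.mem_univ i) fun j _ hj => by
        rw [if_neg hj, map_zero], if_pos rfl] at this
    exact this
  · rw [posVal, map_sum]
    exact Finset.sum_eq_zero fun i _ => h i φ _

theorem outMap_projPos (φ : F k →ₙₐ[k] P k n) (o : Option (Fin l)) (w : P k n) :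
    outMap φ o (projPos k n w) = outMap φ o w := by
  rcases o with _ | y <;> simp [outMap, projPos_apply, proj_proj]

theorem projPos_inMap (φ : F k →ₙₐ[k] P k n) (i : Option (Fin l)) (u : P k n) :
    projPos k n (inMap φ i u) = inMap φ i u := by
  rcases i with _ | y <;> simp [inMap, projPos_apply, proj_proj]

/-- An operator family vanishes on the ideal of positive degree iff four of its blocks do, those given
by two distinct further variables `x_y` and `x_z`: left multiplications by arbitrary elements produce
everything in degree `2`, and right multiplications detect it. -/
theorem projPos_comp_eq_zero_iff (D : OpFamily k m) {y z : Fin l} (hy : m ≤ y) (hz : m ≤ z)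
    (hyz : y ≠ z) :
    (∀ (φ : F k →ₙₐ[k] P k n) (u : P k n),
      projPos k n (D n (degZeroVals m φ) (projPos k n u)) = 0) ↔
    ∀ (s t : Bool) (φ : F k →ₙₐ[k] P k n) (u : P k n),
      block (bif s then some y else none) (bif t then some z else none) D n φ u = 0 := by
  refine ⟨fun h s t φ u => ?_, fun h φ u => ?_⟩
  · change outMap φ _ (D n (degZeroVals m φ) (inMap φ _ u)) = 0
    rw [← outMap_projPos, ← projPos_inMap, h, map_zero]
  · set T := D n (degZeroVals m φ) with hT
    have key (p q : P k n) : ∃ ψ : F k →ₙₐ[k] P k n,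
        D n (degZeroVals m ψ) = T ∧ ψ (x k y) = p ∧ ψ (x k z) = q := by
      obtain ⟨ψ, h1, h2⟩ := exists_hom_append (degZeroVals m φ)
        (fun i => if i = y then p else q)
      refine ⟨ψ, ?_, by simp [h2 _ hy], ?_⟩
      · rw [hT]
        congr 1
        funext i
        rw [degZeroVals, h1]
        simp [degZeroVals, proj_proj]
      · rw [h2 _ hz, if_neg fun h => hyz (Fin.ext h.symm)]
    have h00 (w) : proj k n 1 (T (proj k n 1 w)) = 0 := h false false φ w
    have h10 (w) : proj k n 2 (T (proj k n 1 w)) = 0 := proj_two_eq_zero fun p => by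
      obtain ⟨ψ, hψ, rfl, -⟩ := key p 0
      rw [← hψ]
      exact h true false ψ w
    have h01 (w) : proj k n 1 (T (proj k n 2 w)) = 0 :=
      comp_proj_two_eq_zero (T := proj k n 1 ∘ₗ T) (fun q v => by
        obtain ⟨ψ, hψ, -, rfl⟩ := key 0 q
        rw [← hψ]
        exact h false true ψ v) w
    have h11 (w) : proj k n 2 (T (proj k n 2 w)) = 0 :=
      comp_proj_two_eq_zero (T := proj k n 2 ∘ₗ T) (fun q v => proj_two_eq_zero fun p => by
        obtain ⟨ψ, hψ, rfl, rfl⟩ := key p q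
        rw [← hψ]
        exact h true true ψ v) w
    simp only [projPos_apply, map_add, h00, h10, h01, h11, add_zero]

theorem block_congr (D : OpFamily k m) (hml : m ≤ l) (o i : Option (Fin l))
    {φ ψ : F k →ₙₐ[k] P k n} (h : ∀ j < l, φ (x k j) = ψ (x k j)) :
    block o i D n φ = block o i D n ψ := by
  have hdeg : degZeroVals m φ = degZeroVals m ψ := by
    funext j
    simp [degZeroVals, h j (j.2.trans_le hml)]
  have ho : outMap φ o = outMap ψ o := by rcases o with _ | y <;> simp [outMap, h]
  have hi : inMap φ i = inMap ψ i := by rcases i with _ | y <;> simp [inMap, h]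
  simp only [block, LinearMap.coe_mk, AddHom.coe_mk, hdeg, ho, hi]

/-- An induced block vanishes on `P_n` iff the inducing operator polynomial, applied to a further
variable, gives an identity of `P_n`. -/
theorem isIdentity_iff_block (D : OpFamily k m) (hml : m ≤ l) (o i : Option (Fin l))
    {g : Module.End k (F k)}
    (hg : ∀ (φ : F k →ₙₐ[k] P k n) u, φ (g u) = block o i D n φ (φ u)) :
    IsIdentity k (P k n) (g (x k l)) ↔
      ∀ (φ : F k →ₙₐ[k] P k n) (u : P k n), block o i D n φ u = 0 := by
  refine ⟨fun h φ u => ?_, fun h φ => (hg φ _).trans (h φ _)⟩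
  obtain ⟨ψ, h1, h2⟩ := exists_hom_append (fun j : Fin l => φ (x k j)) fun _ => u
  have := h ψ
  rwa [hg, h2 l le_rfl, block_congr D hml o i fun j hj => h1 ⟨j, hj⟩] at this

/-- The operator identity `z V_{x_1,x_2} = 0` fails in `P_n`, as `(a_{11} c_1) b_{11} = -c_1`. -/
theorem not_isIdentity_V (hn : 0 < n) (hl : 2 ≤ l) :
    ¬ IsIdentity k (P k n) (V k (x k 0) (x k 1) (x k l)) := by
  intro h
  let o : Fin n := ⟨0, hn⟩
  obtain ⟨φ, hφ⟩ := exists_hom (k := k) (n := n) fun i =>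
    if i = 0 then stdBasis k n (a o o) else if i = 1 then stdBasis k n (b o o) else
      stdBasis k n (c o)
  have := h φ
  rw [V_apply, map_mul, map_mul, hφ, hφ, hφ, if_pos rfl, if_neg (by omega), if_neg (by omega),
    if_neg (by omega), if_pos rfl] at this
  simp [stdBasis_mul, table, (stdBasis k n).ne_zero] at this

/-- A polynomial with nonzero linear part is not an identity of `P_n`: substitute `a_{11}` for one
variable and `0` for all others. -/
theorem linear_eq_zero_of_isIdentity (hn : 0 < n) {f : F k} {r : Fin m → k}
    {D : Fin m → OpFamily k m} (hf : ∀ φ : F k →ₙₐ[k] P k n, φ f = linVal φ r + posVal φ D)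
    (h : IsIdentity k (P k n) f) : r = 0 := by
  funext i
  let o : Fin n := ⟨0, hn⟩
  obtain ⟨φ, hφ, -⟩ := exists_hom_append
    (fun j : Fin m => if j = i then stdBasis k n (a o o) else 0) 0
  have := h φ
  have hpos (j : Fin m) : projPos k n (φ (x k j)) = 0 := by
    rw [hφ, apply_ite (projPos k n)]
    simp [projPos_apply, proj_stdBasis, deg]
  rw [hf, posVal, Finset.sum_congr rfl fun j _ => by rw [hpos j, map_zero]] at this
  simpa [linVal, hφ, (stdBasis k n).ne_zero] using this

/-- The equivalence with `4m` operator identities, indexed by a variable and two Booleans that select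
a block, for a polynomial with zero linear part. -/
theorem exists_operator_identities {f : F k} {D : Fin m → OpFamily k m}
    (hD : ∀ i, D i ∈ realizable k m (m + 3))
    (hf : ∀ n (φ : F k →ₙₐ[k] P k n), φ f = posVal φ D) :
    ∃ g : Fin m × Bool × Bool → Module.End k (F k), (∀ i, g i ∈ E0Vars k (m + 3)) ∧
      ∀ n, IsIdentity k (P k n) f ↔ ∀ i, IsIdentity k (P k n) (g i (x k (m + 3))) := by
  let y : Fin (m + 3) := ⟨m, by omega⟩
  let z : Fin (m + 3) := ⟨m + 1, by omega⟩
  choose g hg hφ using fun p : Fin m × Bool × Bool => mem_realizable.1 (hD p.1)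
    (bif p.2.1 then some y else none) (bif p.2.2 then some z else none)
  refine ⟨g, hg, fun n => ?_⟩
  have h1 : IsIdentity k (P k n) f ↔ ∀ φ : F k →ₙₐ[k] P k n, posVal φ D = 0 :=
    forall_congr' fun φ => by rw [hf]
  rw [h1, posVal_eq_zero_iff, Prod.forall]
  refine forall_congr' fun i => ?_
  rw [projPos_comp_eq_zero_iff (D i) (y := y) (z := z) le_rfl (Nat.le_succ m)
    (by simp [y, z]), Prod.forall]
  refine forall_congr' fun s => forall_congr' fun t => ?_
  exact (isIdentity_iff_block (D i) (by omega) _ _ (hφ (i, s, t) n)).symm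

end RAlg

end

theorem mainTheorem3 {k : Type*} [Field k] (m : ℕ) (f : RAlg.F k) (hf : f ∈ RAlg.polys k m) :
    ∃ g : Fin (2 * m * (m + 3)) → Module.End k (RAlg.F k),
      (∀ i, g i ∈ RAlg.E0Vars k (m + 3)) ∧
      ∀ n : ℕ, 2 ≤ n →
        (RAlg.IsIdentity k (RAlg.P k n) f ↔
          ∀ i, RAlg.IsIdentity k (RAlg.P k n) (g i (RAlg.x k (m + 3)))) := by
  obtain ⟨r, D, hD, hfD⟩ := RAlg.exists_expansion (Nat.le_add_right m 3) hf
  by_cases hr : r = 0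
  · obtain ⟨g, hg, hgf⟩ := RAlg.exists_operator_identities hD fun n φ => by
      rw [hfD, hr, RAlg.linVal]
      simp
    obtain ⟨e⟩ : Nonempty (Fin m × Bool × Bool ↪ Fin (2 * m * (m + 3))) := by
      refine Function.Embedding.nonempty_of_card_le ?_
      simp only [Fintype.card_prod, Fintype.card_fin, Fintype.card_bool]
      nlinarith
    -- The list of `4m` identities is padded with zero operators.
    refine ⟨Function.extend e g 0, fun j => ?_,
      fun n _ => (hgf n).trans ⟨fun h j => ?_, fun h i => ?_⟩⟩
    · by_cases hj : ∃ i, e i = j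
      · obtain ⟨i, rfl⟩ := hj
        rw [e.injective.extend_apply]
        exact hg i
      · rw [Function.extend_apply' _ _ _ hj]
        exact zero_mem _
    · by_cases hj : ∃ i, e i = j
      · obtain ⟨i, rfl⟩ := hj
        rw [e.injective.extend_apply]
        exact h i
      · rw [Function.extend_apply' _ _ _ hj]
        exact fun φ => map_zero φ
    · simpa only [e.injective.extend_apply] using h (e i)
  · have hm : 0 < m := by
      refine Nat.pos_of_ne_zero ?_
      rintro rfl
      exact hr (Subsingleton.elim _ _)
    refine ⟨fun _ => RAlg.V k (RAlg.x k 0) (RAlg.x k 1), fun _ =>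
      RAlg.V_mem_E0Vars (by omega) (by omega), fun n hn => ⟨fun h => ?_, fun h => ?_⟩⟩
    · exact absurd (RAlg.linear_eq_zero_of_isIdentity (by omega) (hfD n) h) hr
    · exact absurd (h ⟨0, by positivity⟩) (RAlg.not_isIdentity_V (by omega) (by omega))
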